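/- For $m\ge 1$ let $\mathfrak{sp}(m,\mathbb R)=\{M\in\mathfrak{gl}_{2m}(\mathbb R): M^T J_m+J_mM=0\}$ with $J_m=\begin{bmatrix}0&I_m\\-I_m&0\end{bmatrix}$. Let $\mathbb R^{2n,2n}$ denote $\mathbb R^{4n}$ regarded as a module over $\mathfrak{sp}(n,\mathbb R)\oplus\mathfrak{sp}(1,\mathbb R)$ through the inclusion into $\mathfrak{so}(2n,2n)=\left\{M\in\mathfrak{gl}_{4n}(\mathbb R): M^TS+SM=0\right\}$, $S=\begin{bmatrix}0&I_{2n}\\I_{2n}&0\end{bmatrix}$, given by $$\left(\begin{bmatrix}A&B\\C&-A^T\end{bmatrix},\begin{bmatrix}a&b\\c&-a\end{bmatrix}\right)\mapsto \begin{bmatrix}A+aI_n&B&0&bI_n\\C&-A^T+aI_n&-bI_n&0\\0&-cI_n&-A^T-aI_n&-C\\cI_n&0&-B&A-aI_n\end{bmatrix}.$$ **Lemma.** Let $n\ge 3$, and let $\mathfrak{sp}(n+1,\mathbb R)=\mathfrak{sp}(n,\mathbb R)\oplus\mathfrak{sp}(1,\mathbb R)\oplus\mathbb R^{2n,2n}$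 be a decomposition into $(\mathfrak{sp}(n,\mathbb R)\oplus\mathfrak{sp}(1,\mathbb R))$-modules; that is, we are given a Lie algebra homomorphism $\iota:\mathfrak{sp}(n,\mathbb R)\oplus\mathfrak{sp}(1,\mathbb R)\to\mathfrak{sp}(n+1,\mathbb R)$ and a linear map $\varphi:\mathbb R^{2n,2n}\to\mathfrak{sp}(n+1,\mathbb R)$ with $\varphi(x\cdot v)=[\iota(x),\varphi(v)]$ for all $x,v$, such that $(x,v)\mapsto\iota(x)+\varphi(v)$ is bijective. Let $\langle\cdot,\cdot\rangle_n$, $\langle\cdot,\cdot\rangle_1$, $\langle\cdot,\cdot\rangle_0$ be inner products, i.e. non-degenerate (not necessarily definite) symmetric bilinear forms, on $\mathfrak{sp}(n,\mathbb R)$, $\mathfrak{sp}(1,\mathbb R)$ and $\mathbb R^{2n,2n}$, such that $\langle\cdot,\cdot\rangle_n$ is $\mathfrak{sp}(n,\mathbb R)$-invariant, $\langle\cdot,\cdot\rangle_1$ is $\mathfrak{sp}(1,\mathbb R)$-invariant (both for the adjoint action) and $\langle\cdot,\cdot\rangle_0$ is $(\mathfrak{sp}(n,\mathbb R)\oplus\mathfrak{sp}(1,\mathbb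 R))$-invariant. (A form is invariant if $\langle x\cdot y,z\rangle=-\langle y,x\cdot z\rangle$.) Then there exist $a_0,a_1,a_n\in\mathbb R$ such that, under the decomposition, $a_0\langle\cdot,\cdot\rangle_0+a_1\langle\cdot,\cdot\rangle_1+a_n\langle\cdot,\cdot\rangle_n$ is the Killing form $\mathsf K$ of $\mathfrak{sp}(n+1,\mathbb R)$: $$\mathsf K\big(\iota(X,Y)+\varphi(v),\,\iota(X',Y')+\varphi(v')\big)=a_0\langle v,v'\rangle_0+a_1\langle Y,Y'\rangle_1+a_n\langle X,X'\rangle_n$$ for all $X,X'\in\mathfrak{sp}(n,\mathbb R)$, $Y,Y'\in\mathfrak{sp}(1,\mathbb R)$, $v,v'\in\mathbb R^{2n,2n}$. -/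

import Mathlib

open scoped Matrix

attribute [local instance 100] LieRing.ofAssociativeRing

namespace SympDecomp

noncomputable section

/-- `sp(n, ℝ)`: the real `2n × 2n` matrices `M` with `Mᵀ J + J M = 0`, where `J` is the standard
skew-symmetric matrix. -/
abbrev sp (n : ℕ) : LieSubalgebra ℝ (Matrix (Fin n ⊕ Fin n) (Fin n ⊕ Fin n) ℝ) :=
  LieAlgebra.Symplectic.sp (Fin n) ℝ

/-- `so(2n, 2n)`: the real `4n × 4n` matrices `M` with `Mᵀ S + S M = 0`, where `S` is the symmetric
matrix `[0, 1; 1, 0]` of signature `(2n, 2n)`. -/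
abbrev so22 (n : ℕ) : LieSubalgebra ℝ
    (Matrix ((Fin n ⊕ Fin n) ⊕ (Fin n ⊕ Fin n)) ((Fin n ⊕ Fin n) ⊕ (Fin n ⊕ Fin n)) ℝ) :=
  LieAlgebra.Orthogonal.typeD (Fin n ⊕ Fin n) ℝ

theorem mem_sp {l : Type*} [Fintype l] [DecidableEq l] {X : Matrix (l ⊕ l) (l ⊕ l) ℝ} :
    X ∈ LieAlgebra.Symplectic.sp l ℝ ↔ Xᵀ * Matrix.J l ℝ = -(Matrix.J l ℝ * X) := by
  rw [LieAlgebra.Symplectic.sp, mem_skewAdjointMatricesLieSubalgebra,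
    mem_skewAdjointMatricesSubmodule, Matrix.IsSkewAdjoint, Matrix.IsAdjointPair, Matrix.mul_neg]

theorem mem_sp_iff {l : Type*} [Fintype l] [DecidableEq l] {X : Matrix (l ⊕ l) (l ⊕ l) ℝ} :
    X ∈ LieAlgebra.Symplectic.sp l ℝ ↔
      (∀ i j, X (Sum.inr i) (Sum.inr j) = -X (Sum.inl j) (Sum.inl i)) ∧
      (∀ i j, X (Sum.inl i) (Sum.inr j) = X (Sum.inl j) (Sum.inr i)) ∧
      (∀ i j, X (Sum.inr i) (Sum.inl j) = X (Sum.inr j) (Sum.inl i)) := by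
  rw [mem_sp]
  obtain ⟨A, B, C, D, rfl⟩ : ∃ A B C D, X = Matrix.fromBlocks A B C D :=
    ⟨_, _, _, _, (Matrix.fromBlocks_toBlocks X).symm⟩
  rw [Matrix.J, Matrix.fromBlocks_transpose, Matrix.fromBlocks_multiply,
    Matrix.fromBlocks_multiply, Matrix.fromBlocks_neg, Matrix.fromBlocks_inj]
  simp only [Matrix.mul_zero, Matrix.mul_one, Matrix.mul_neg, Matrix.zero_mul, Matrix.one_mul,
    Matrix.neg_mul, zero_add, add_zero, neg_neg, ← Matrix.ext_iff, Matrix.transpose_apply,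
    Matrix.neg_apply, Matrix.fromBlocks_apply₁₁, Matrix.fromBlocks_apply₁₂,
    Matrix.fromBlocks_apply₂₁, Matrix.fromBlocks_apply₂₂]
  constructor
  · rintro ⟨h1, h2, h3, h4⟩
    refine ⟨fun i j => ?_, fun i j => ?_, fun i j => ?_⟩
    · rw [← h3 j i]
    · have := h4 j i; linarith
    · have := h1 j i; linarith
  · rintro ⟨h1, h2, h3⟩
    exact ⟨fun i j => h3 j i, fun i j => by rw [h1 i j], fun i j => by rw [h1 j i],
      fun i j => by rw [h2 j i]⟩

theorem sp_mul_J {l : Type*} [Fintype l] [DecidableEq l] {X : Matrix (l ⊕ l) (l ⊕ l) ℝ}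
    (hX : X ∈ LieAlgebra.Symplectic.sp l ℝ) :
    Matrix.J l ℝ * Xᵀ = -(X * Matrix.J l ℝ) := by
  have h := congrArg (fun M => Matrix.J l ℝ * M * Matrix.J l ℝ) (mem_sp.1 hX)
  have hJ := Matrix.J_squared l ℝ
  simp only [mul_neg, neg_mul, mul_assoc, hJ] at h
  simp only [← mul_assoc, hJ, neg_mul, one_mul, mul_one, neg_neg] at h
  rw [← h, neg_neg]

/-- The matrix by which `(X, Y) ∈ sp(n, ℝ) ⊕ sp(1, ℝ)`, with `X = [A, B; C, -Aᵀ]` and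
`Y = [a, b; c, -a]`, acts on `ℝ^{2n,2n}`; in `n × n` blocks it is
`[A + a, B, 0, b; C, -Aᵀ + a, -b, 0; 0, -c, -Aᵀ - a, -C; c, 0, -B, A - a]`. -/
def actMatrix (n : ℕ) (x : sp n × sp 1) :
    Matrix ((Fin n ⊕ Fin n) ⊕ (Fin n ⊕ Fin n)) ((Fin n ⊕ Fin n) ⊕ (Fin n ⊕ Fin n)) ℝ :=
  let X : Matrix (Fin n ⊕ Fin n) (Fin n ⊕ Fin n) ℝ := x.1
  let Y : Matrix (Fin 1 ⊕ Fin 1) (Fin 1 ⊕ Fin 1) ℝ := x.2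
  let a : ℝ := Y (Sum.inl 0) (Sum.inl 0)
  let b : ℝ := Y (Sum.inl 0) (Sum.inr 0)
  let c : ℝ := Y (Sum.inr 0) (Sum.inl 0)
  Matrix.fromBlocks (X + a • 1) (b • Matrix.fromBlocks 0 1 (-1) 0)
    (c • Matrix.fromBlocks 0 (-1) 1 0) (-Xᵀ - a • 1)

theorem actMatrix_eq (n : ℕ) (x : sp n × sp 1) : actMatrix n x =
    Matrix.fromBlocks (x.1.1 + x.2.1 (Sum.inl 0) (Sum.inl 0) • 1)
      (-(x.2.1 (Sum.inl 0) (Sum.inr 0) • Matrix.J (Fin n) ℝ))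
      (x.2.1 (Sum.inr 0) (Sum.inl 0) • Matrix.J (Fin n) ℝ)
      (-x.1.1ᵀ - x.2.1 (Sum.inl 0) (Sum.inl 0) • 1) := by
  simp only [actMatrix, Matrix.J, ← smul_neg, Matrix.fromBlocks_neg, neg_neg, neg_zero]

theorem actMatrix_mem (n : ℕ) (x : sp n × sp 1) : actMatrix n x ∈ so22 n := by
  rw [actMatrix_eq]
  simp only [so22, LieAlgebra.Orthogonal.typeD, mem_skewAdjointMatricesLieSubalgebra,
    mem_skewAdjointMatricesSubmodule, Matrix.IsSkewAdjoint, Matrix.IsAdjointPair,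
    LieAlgebra.Orthogonal.JD, Matrix.fromBlocks_transpose, Matrix.fromBlocks_multiply,
    Matrix.fromBlocks_neg, Matrix.fromBlocks_inj]
  simp [Matrix.J_transpose, sub_eq_add_neg, add_comm]

theorem actMatrix_add (n : ℕ) (x y : sp n × sp 1) :
    actMatrix n (x + y) = actMatrix n x + actMatrix n y := by
  obtain ⟨⟨X, hX⟩, ⟨Y, hY⟩⟩ := x
  obtain ⟨⟨X', hX'⟩, ⟨Y', hY'⟩⟩ := y
  simp only [actMatrix_eq, Prod.mk_add_mk, AddMemClass.mk_add_mk, Matrix.add_apply,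
    Matrix.fromBlocks_add, Matrix.transpose_add]
  rw [Matrix.fromBlocks_inj]
  exact ⟨by module, by module, by module, by module⟩

theorem actMatrix_smul (n : ℕ) (r : ℝ) (x : sp n × sp 1) :
    actMatrix n (r • x) = r • actMatrix n x := by
  obtain ⟨⟨X, hX⟩, ⟨Y, hY⟩⟩ := x
  simp only [actMatrix_eq, Prod.smul_mk, SetLike.mk_smul_mk, Matrix.smul_apply,
    Matrix.fromBlocks_smul, Matrix.transpose_smul, smul_eq_mul]
  rw [Matrix.fromBlocks_inj]
  exact ⟨by module, by module, by module, by module⟩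

theorem actMatrix_lie (n : ℕ) (x y : sp n × sp 1) :
    actMatrix n ⁅x, y⁆ = ⁅actMatrix n x, actMatrix n y⁆ := by
  obtain ⟨⟨X, hX⟩, ⟨Y, hY⟩⟩ := x
  obtain ⟨⟨X', hX'⟩, ⟨Y', hY'⟩⟩ := y
  have e1 := (mem_sp_iff.1 hY).1 0 0
  have e2 := (mem_sp_iff.1 hY').1 0 0
  have h := mem_sp.1 hX
  have h' := mem_sp.1 hX'
  have hJ := Matrix.J_squared (Fin n) ℝ
  have hc := sp_mul_J hX
  have hc' := sp_mul_J hX'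
  simp only [actMatrix_eq, LieAlgebra.Prod.bracket_apply, LieSubalgebra.coe_bracket,
    Ring.lie_def, Matrix.fromBlocks_multiply]
  rw [sub_eq_add_neg (Matrix.fromBlocks _ _ _ _), Matrix.fromBlocks_neg, Matrix.fromBlocks_add,
    Matrix.fromBlocks_inj]
  have hs : ∀ (M N : Matrix (Fin 1 ⊕ Fin 1) (Fin 1 ⊕ Fin 1) ℝ) (i j : Fin 1 ⊕ Fin 1),
      (M * N) i j = M i (Sum.inl 0) * N (Sum.inl 0) j + M i (Sum.inr 0) * N (Sum.inr 0) j := by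
    intro M N i j
    simp [Matrix.mul_apply]
  simp only [Matrix.sub_apply, hs, e1, e2]
  generalize Y (Sum.inl 0) (Sum.inl 0) = a
  generalize Y (Sum.inl 0) (Sum.inr 0) = b
  generalize Y (Sum.inr 0) (Sum.inl 0) = c
  generalize Y' (Sum.inl 0) (Sum.inl 0) = a'
  generalize Y' (Sum.inl 0) (Sum.inr 0) = b'
  generalize Y' (Sum.inr 0) (Sum.inl 0) = c'
  refine ⟨?_, ?_, ?_, ?_⟩
  · simp only [add_mul, mul_add, smul_mul_assoc, mul_smul_comm, neg_mul, hJ, one_mul, mul_one]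
    module
  · simp only [add_mul, mul_sub, smul_mul_assoc, mul_smul_comm, neg_mul, mul_neg,
      one_mul, mul_one, hc, hc']
    module
  · simp only [mul_add, sub_mul, smul_mul_assoc, mul_smul_comm, neg_mul, one_mul, mul_one, h, h']
    module
  · simp only [sub_mul, mul_sub, smul_mul_assoc, mul_smul_comm, neg_mul, mul_neg,
      hJ, one_mul, mul_one, Matrix.transpose_sub, Matrix.transpose_mul]
    module

/-- The inclusion `sp(n, ℝ) ⊕ sp(1, ℝ) → so(2n, 2n)`. -/
def rep (n : ℕ) : (sp n × sp 1) →ₗ⁅ℝ⁆ so22 n where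
  toFun x := ⟨actMatrix n x, actMatrix_mem n x⟩
  map_add' x y := Subtype.ext (actMatrix_add n x y)
  map_smul' r x := Subtype.ext (actMatrix_smul n r x)
  map_lie' {x y} := Subtype.ext (actMatrix_lie n x y)

/-- The vector space `ℝ^{2n,2n}` on which `so(2n, 2n)` acts. -/
abbrev R22 (n : ℕ) : Type := (Fin n ⊕ Fin n) ⊕ (Fin n ⊕ Fin n) → ℝ

/-- `ℝ^{2n,2n}` as a module over `sp(n, ℝ) ⊕ sp(1, ℝ)`, through the inclusion into `so(2n, 2n)`. -/
instance instLieRingModuleR22 (n : ℕ) : LieRingModule (sp n × sp 1) (R22 n) where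
  bracket x v := (rep n x).1 *ᵥ v
  add_lie x y v := by
    change actMatrix n (x + y) *ᵥ v = actMatrix n x *ᵥ v + actMatrix n y *ᵥ v
    rw [actMatrix_add, Matrix.add_mulVec]
  lie_add x v w := Matrix.mulVec_add _ _ _
  leibniz_lie x y v := by
    change actMatrix n x *ᵥ (actMatrix n y *ᵥ v) =
      actMatrix n ⁅x, y⁆ *ᵥ v + actMatrix n y *ᵥ (actMatrix n x *ᵥ v)
    rw [actMatrix_lie, Ring.lie_def, Matrix.sub_mulVec, ← Matrix.mulVec_mulVec,
      ← Matrix.mulVec_mulVec, sub_add_cancel]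

theorem lie_R22 (n : ℕ) (x : sp n × sp 1) (v : R22 n) : ⁅x, v⁆ = actMatrix n x *ᵥ v := rfl

instance instLieModuleR22 (n : ℕ) : LieModule ℝ (sp n × sp 1) (R22 n) where
  smul_lie r x v := by
    rw [lie_R22, lie_R22, actMatrix_smul, Matrix.smul_mulVec]
  lie_smul r x v := Matrix.mulVec_smul _ _ _

/-- A decomposition `sp(n+1, ℝ) = sp(n, ℝ) ⊕ sp(1, ℝ) ⊕ ℝ^{2n,2n}`: an inclusion of the Lie algebra
`sp(n, ℝ) ⊕ sp(1, ℝ)` into `sp(n+1, ℝ)`, together with an isomorphism of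
`(sp(n, ℝ) ⊕ sp(1, ℝ))`-modules from `ℝ^{2n,2n}` onto a complement of its image. -/
structure Decomposition (n : ℕ) where
  incl : (sp n × sp 1) →ₗ⁅ℝ⁆ sp (n + 1)
  emb : R22 n →ₗ[ℝ] sp (n + 1)
  emb_lie : ∀ (x : sp n × sp 1) (v : R22 n), emb ⁅x, v⁆ = ⁅incl x, emb v⁆
  bijective : Function.Bijective fun p : (sp n × sp 1) × R22 n => incl p.1 + emb p.2

/-- The reordering of coordinates that splits `ℝ^{2(n+1)}` as `ℝ^{2n} ⊕ ℝ^2`. -/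
def splitEquiv (n : ℕ) : Fin (n + 1) ⊕ Fin (n + 1) ≃ (Fin n ⊕ Fin n) ⊕ (Fin 1 ⊕ Fin 1) :=
  (Equiv.sumCongr finSumFinEquiv.symm finSumFinEquiv.symm).trans
    (Equiv.sumSumSumComm (Fin n) (Fin 1) (Fin n) (Fin 1))

theorem splitEquiv_J (n : ℕ) : (Matrix.fromBlocks (Matrix.J (Fin n) ℝ) 0 0
    (Matrix.J (Fin 1) ℝ)).submatrix (splitEquiv n) (splitEquiv n) = Matrix.J (Fin (n + 1)) ℝ := by
  have : Matrix.fromBlocks (Matrix.J (Fin n) ℝ) 0 0 (Matrix.J (Fin 1) ℝ) =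
      (Matrix.J (Fin (n + 1)) ℝ).submatrix (splitEquiv n).symm (splitEquiv n).symm := by
    ext i j
    rcases i with (i | i) | (i | i) <;> rcases j with (j | j) | (j | j) <;>
      simp [splitEquiv, Matrix.J, Matrix.one_apply, Fin.ext_iff] <;> omega
  rw [this, Matrix.submatrix_submatrix]
  simp

theorem submatrix_add' {l m : Type*} (A B : Matrix m m ℝ) (f : l → m) :
    A.submatrix f f + B.submatrix f f = (A + B).submatrix f f := rfl

theorem submatrix_smul' {l m : Type*} (r : ℝ) (A : Matrix m m ℝ) (f : l → m) :
    r • A.submatrix f f = (r • A).submatrix f f := rfl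

theorem split_mem {n : ℕ}
    {N : Matrix ((Fin n ⊕ Fin n) ⊕ (Fin 1 ⊕ Fin 1)) ((Fin n ⊕ Fin n) ⊕ (Fin 1 ⊕ Fin 1)) ℝ} :
    N.submatrix (splitEquiv n) (splitEquiv n) ∈ sp (n + 1) ↔
      Nᵀ * Matrix.fromBlocks (Matrix.J (Fin n) ℝ) 0 0 (Matrix.J (Fin 1) ℝ) =
        -(Matrix.fromBlocks (Matrix.J (Fin n) ℝ) 0 0 (Matrix.J (Fin 1) ℝ) * N) := by
  rw [mem_sp, ← splitEquiv_J, Matrix.transpose_submatrix, Matrix.submatrix_mul_equiv,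
    Matrix.submatrix_mul_equiv]
  constructor
  · intro h
    ext i j
    have := congrFun (congrFun h ((splitEquiv n).symm i)) ((splitEquiv n).symm j)
    simpa only [Matrix.neg_apply, Matrix.submatrix_apply, Equiv.apply_symm_apply] using this
  · intro h
    rw [h]
    rfl

/-- The off-diagonal block attached to a vector of `ℝ^{2n,2n}`. -/
def offDiag (n : ℕ) (v : R22 n) : Matrix (Fin n ⊕ Fin n) (Fin 1 ⊕ Fin 1) ℝ :=
  Matrix.of fun i => Sum.elim (fun _ => (Matrix.J (Fin n) ℝ *ᵥ (v ∘ Sum.inr)) i)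
    (fun _ => v (Sum.inl i))

theorem offDiag_add (n : ℕ) (v w : R22 n) : offDiag n (v + w) = offDiag n v + offDiag n w := by
  ext i (j | j)
  · have : (v + w) ∘ Sum.inr = v ∘ Sum.inr + w ∘ Sum.inr := rfl
    simp only [offDiag, Matrix.of_apply, Sum.elim_inl, Matrix.add_apply, this, Matrix.mulVec_add,
      Pi.add_apply]
  · simp [offDiag]

theorem offDiag_smul (n : ℕ) (r : ℝ) (v : R22 n) : offDiag n (r • v) = r • offDiag n v := by
  ext i (j | j)
  · have : (r • v) ∘ Sum.inr = r • (v ∘ Sum.inr) := rfl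
    simp only [offDiag, Matrix.of_apply, Sum.elim_inl, Matrix.smul_apply, this, Matrix.mulVec_smul,
      Pi.smul_apply]
  · simp [offDiag]

theorem offDiag_lie (n : ℕ) (x : sp n × sp 1) (v : R22 n) :
    offDiag n ⁅x, v⁆ = x.1.1 * offDiag n v - offDiag n v * x.2.1 := by
  obtain ⟨⟨X, hX⟩, ⟨Y, hY⟩⟩ := x
  have e1 := (mem_sp_iff.1 hY).1 0 0
  obtain ⟨v1, v2, rfl⟩ : ∃ v1 v2, v = Sum.elim v1 v2 :=
    ⟨_, _, (Sum.elim_comp_inl_inr v).symm⟩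
  rw [lie_R22, actMatrix_eq, Matrix.fromBlocks_mulVec]
  simp only [Sum.elim_comp_inl, Sum.elim_comp_inr]
  have hl : ∀ i, (X * offDiag n (Sum.elim v1 v2)) i (Sum.inl 0) =
      (X *ᵥ (Matrix.J (Fin n) ℝ *ᵥ v2)) i := fun i => rfl
  have hr : ∀ i, (X * offDiag n (Sum.elim v1 v2)) i (Sum.inr 0) = (X *ᵥ v1) i := fun i => rfl
  have hYm : ∀ i j, (offDiag n (Sum.elim v1 v2) * Y) i j =
      (Matrix.J (Fin n) ℝ *ᵥ v2) i * Y (Sum.inl 0) j + v1 i * Y (Sum.inr 0) j := by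
    intro i j
    simp [Matrix.mul_apply, offDiag]
  ext i (j | j)
  · obtain rfl : j = 0 := Subsingleton.elim _ _
    rw [Matrix.sub_apply, hl, hYm]
    simp only [offDiag, Matrix.of_apply, Sum.elim_inl, Sum.elim_comp_inr, Matrix.mulVec_add,
      Matrix.sub_mulVec, Matrix.neg_mulVec, Matrix.mulVec_sub, Matrix.mulVec_neg,
      Matrix.mulVec_mulVec, sp_mul_J hX, Matrix.J_squared, Matrix.smul_mulVec, Matrix.mulVec_smul,
      Matrix.one_mulVec, Pi.add_apply, Pi.sub_apply, Pi.neg_apply, Pi.smul_apply, smul_eq_mul]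
    ring
  · obtain rfl : j = 0 := Subsingleton.elim _ _
    rw [Matrix.sub_apply, hr, hYm]
    simp only [offDiag, Matrix.of_apply, Sum.elim_inl, Sum.elim_inr,
      Matrix.add_mulVec, Matrix.neg_mulVec, Matrix.smul_mulVec, e1,
      Matrix.one_mulVec, Pi.add_apply, Pi.neg_apply, Pi.smul_apply, smul_eq_mul]
    ring

theorem diag_mem {n : ℕ} (x : sp n × sp 1) :
    (Matrix.fromBlocks x.1.1 0 0 x.2.1).submatrix (splitEquiv n) (splitEquiv n) ∈ sp (n + 1) := by
  rw [split_mem]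
  simp [Matrix.fromBlocks_transpose, Matrix.fromBlocks_multiply, Matrix.fromBlocks_neg,
    mem_sp.1 x.1.2, mem_sp.1 x.2.2]

theorem off_mem {n : ℕ} (U : Matrix (Fin n ⊕ Fin n) (Fin 1 ⊕ Fin 1) ℝ) :
    (Matrix.fromBlocks 0 U (Matrix.J (Fin 1) ℝ * Uᵀ * Matrix.J (Fin n) ℝ) 0).submatrix
      (splitEquiv n) (splitEquiv n) ∈ sp (n + 1) := by
  rw [split_mem]
  have h1 := Matrix.J_squared (Fin 1) ℝ
  have hn := Matrix.J_squared (Fin n) ℝ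
  rw [Matrix.fromBlocks_transpose, Matrix.fromBlocks_multiply, Matrix.fromBlocks_multiply,
    Matrix.fromBlocks_neg, Matrix.fromBlocks_inj]
  refine ⟨by simp, ?_, ?_, by simp⟩
  · simp only [Matrix.transpose_mul, Matrix.transpose_transpose, Matrix.J_transpose, Matrix.mul_neg,
      Matrix.neg_mul, Matrix.mul_zero, zero_add, add_zero, Matrix.mul_assoc, h1,
      Matrix.mul_one, neg_neg]
  · simp only [Matrix.mul_zero, zero_add, add_zero, ← Matrix.mul_assoc, h1,
      Matrix.neg_mul, Matrix.one_mul, neg_neg]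

/-- The standard decomposition of `sp(n+1, ℝ)`: block-diagonal and block-off-diagonal matrices with
respect to `ℝ^{2(n+1)} = ℝ^{2n} ⊕ ℝ^2`. -/
def standardDecomposition (n : ℕ) : Decomposition n where
  incl :=
    { toFun := fun x => ⟨_, diag_mem x⟩
      map_add' := fun x y => Subtype.ext <| by
        change Matrix.submatrix (Matrix.fromBlocks (x.1.1 + y.1.1) 0 0 (x.2.1 + y.2.1)) _ _ =
          Matrix.submatrix _ _ _ + Matrix.submatrix _ _ _
        rw [submatrix_add', Matrix.fromBlocks_add]
        simp
      map_smul' := fun r x => Subtype.ext <| by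
        change Matrix.submatrix (Matrix.fromBlocks (r • x.1.1) 0 0 (r • x.2.1)) _ _ =
          r • Matrix.submatrix _ _ _
        rw [submatrix_smul', Matrix.fromBlocks_smul]
        simp
      map_lie' := fun {x y} => Subtype.ext <| by
        change Matrix.submatrix (Matrix.fromBlocks (x.1.1 * y.1.1 - y.1.1 * x.1.1) 0 0
            (x.2.1 * y.2.1 - y.2.1 * x.2.1)) _ _ =
          Matrix.submatrix _ _ _ * Matrix.submatrix _ _ _ -
            Matrix.submatrix _ _ _ * Matrix.submatrix _ _ _
        rw [Matrix.submatrix_mul_equiv, Matrix.submatrix_mul_equiv, Matrix.fromBlocks_multiply,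
          Matrix.fromBlocks_multiply]
        ext i j
        rw [Matrix.sub_apply, Matrix.submatrix_apply, Matrix.submatrix_apply,
          Matrix.submatrix_apply]
        rcases splitEquiv n i with i | i <;> rcases splitEquiv n j with j | j <;> simp }
  emb :=
    { toFun := fun v => ⟨_, off_mem (offDiag n v)⟩
      map_add' := fun v w => Subtype.ext <| by
        change Matrix.submatrix _ _ _ = Matrix.submatrix _ _ _ + Matrix.submatrix _ _ _
        rw [submatrix_add', Matrix.fromBlocks_add, offDiag_add]
        simp [Matrix.mul_add, Matrix.add_mul]
      map_smul' := fun r v => Subtype.ext <| by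
        change Matrix.submatrix _ _ _ = r • Matrix.submatrix _ _ _
        rw [submatrix_smul', Matrix.fromBlocks_smul, offDiag_smul]
        simp }
  emb_lie x v := Subtype.ext <| by
    change Matrix.submatrix (Matrix.fromBlocks 0 (offDiag n ⁅x, v⁆)
        (Matrix.J (Fin 1) ℝ * (offDiag n ⁅x, v⁆)ᵀ * Matrix.J (Fin n) ℝ) 0) _ _ =
      Matrix.submatrix _ _ _ * Matrix.submatrix _ _ _ -
        Matrix.submatrix _ _ _ * Matrix.submatrix _ _ _
    rw [Matrix.submatrix_mul_equiv, Matrix.submatrix_mul_equiv, Matrix.fromBlocks_multiply,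
      Matrix.fromBlocks_multiply, offDiag_lie]
    have key : Matrix.J (Fin 1) ℝ * (x.1.1 * offDiag n v - offDiag n v * x.2.1)ᵀ *
        Matrix.J (Fin n) ℝ = x.2.1 * (Matrix.J (Fin 1) ℝ * (offDiag n v)ᵀ * Matrix.J (Fin n) ℝ) -
          (Matrix.J (Fin 1) ℝ * (offDiag n v)ᵀ * Matrix.J (Fin n) ℝ) * x.1.1 := by
      simp only [Matrix.transpose_sub, Matrix.transpose_mul, Matrix.mul_sub, Matrix.sub_mul,
        ← Matrix.mul_assoc, sp_mul_J x.2.2, Matrix.neg_mul]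
      simp only [Matrix.mul_assoc, mem_sp.1 x.1.2, Matrix.mul_neg]
      abel
    rw [key]
    ext i j
    rw [Matrix.sub_apply, Matrix.submatrix_apply, Matrix.submatrix_apply, Matrix.submatrix_apply]
    rcases splitEquiv n i with i | i <;> rcases splitEquiv n j with j | j <;> simp
  bijective := by
    have val : ∀ p : (sp n × sp 1) × R22 n,
        (Matrix.fromBlocks p.1.1.1 0 0 p.1.2.1).submatrix (splitEquiv n) (splitEquiv n) +
          (Matrix.fromBlocks 0 (offDiag n p.2)
            (Matrix.J (Fin 1) ℝ * (offDiag n p.2)ᵀ * Matrix.J (Fin n) ℝ) 0).submatrix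
            (splitEquiv n) (splitEquiv n) =
        (Matrix.fromBlocks p.1.1.1 (offDiag n p.2)
          (Matrix.J (Fin 1) ℝ * (offDiag n p.2)ᵀ * Matrix.J (Fin n) ℝ) p.1.2.1).submatrix
            (splitEquiv n) (splitEquiv n) := by
      intro p
      rw [submatrix_add', Matrix.fromBlocks_add]
      simp
    constructor
    · rintro p q h
      have h2 := (val p).symm.trans ((congrArg Subtype.val h).trans (val q))
      have h3 := congrArg (fun M => M.submatrix (splitEquiv n).symm (splitEquiv n).symm) h2
      simp only [Matrix.submatrix_submatrix, Equiv.self_comp_symm, Matrix.submatrix_id_id,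
        Matrix.fromBlocks_inj] at h3
      obtain ⟨hX, hU, -, hY⟩ := h3
      obtain ⟨⟨X, Y⟩, v⟩ := p
      obtain ⟨⟨X', Y'⟩, v'⟩ := q
      have hv : v = v' := by
        have hl : Matrix.J (Fin n) ℝ *ᵥ (v ∘ Sum.inr) = Matrix.J (Fin n) ℝ *ᵥ (v' ∘ Sum.inr) :=
          funext fun i => congrFun (congrFun hU i) (Sum.inl 0)
        have hl2 := congrArg (fun w => Matrix.J (Fin n) ℝ *ᵥ w) hl
        simp only [Matrix.mulVec_mulVec, Matrix.J_squared, Matrix.neg_mulVec, Matrix.one_mulVec,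
          neg_inj] at hl2
        ext (i | i)
        · exact congrFun (congrFun hU i) (Sum.inr 0)
        · exact congrFun hl2 i
      exact Prod.ext (Prod.ext (Subtype.ext hX) (Subtype.ext hY)) hv
    · rintro ⟨M, hM⟩
      obtain ⟨X, U, W, Y, hN⟩ : ∃ X U W Y,
          M.submatrix (splitEquiv n).symm (splitEquiv n).symm = Matrix.fromBlocks X U W Y :=
        ⟨_, _, _, _, (Matrix.fromBlocks_toBlocks _).symm⟩
      obtain rfl : M = (Matrix.fromBlocks X U W Y).submatrix (splitEquiv n) (splitEquiv n) := by
        rw [← hN, Matrix.submatrix_submatrix]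
        simp
      rw [split_mem, Matrix.fromBlocks_transpose, Matrix.fromBlocks_multiply,
        Matrix.fromBlocks_multiply, Matrix.fromBlocks_neg, Matrix.fromBlocks_inj] at hM
      simp only [Matrix.mul_zero, Matrix.zero_mul, add_zero, zero_add] at hM
      obtain ⟨h1, -, h3, h4⟩ := hM
      refine ⟨((⟨X, mem_sp.2 h1⟩, ⟨Y, mem_sp.2 h4⟩),
        Sum.elim (fun i => U i (Sum.inr 0))
          (-(Matrix.J (Fin n) ℝ *ᵥ fun i => U i (Sum.inl 0)))), Subtype.ext ((val _).trans ?_)⟩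
      have hU : offDiag n (Sum.elim (fun i => U i (Sum.inr 0))
          (-(Matrix.J (Fin n) ℝ *ᵥ fun i => U i (Sum.inl 0)))) = U := by
        ext i (j | j)
        · obtain rfl : j = 0 := Subsingleton.elim _ _
          simp only [offDiag, Matrix.of_apply, Sum.elim_inl, Sum.elim_comp_inr, Matrix.mulVec_neg,
            Matrix.mulVec_mulVec, Matrix.J_squared, Matrix.neg_mulVec, Matrix.one_mulVec, neg_neg]
        · obtain rfl : j = 0 := Subsingleton.elim _ _
          rfl
      have hW : Matrix.J (Fin 1) ℝ * Uᵀ * Matrix.J (Fin n) ℝ = W := by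
        rw [Matrix.mul_assoc, h3, Matrix.mul_neg, ← Matrix.mul_assoc, Matrix.J_squared,
          Matrix.neg_mul, Matrix.one_mul, neg_neg]
      rw [hU, hW]

end

end SympDecomp

/-! The Killing form is symmetric and invariant, so two facts suffice: the three summands are
pairwise orthogonal for it, and on each summand a symmetric invariant form is unique up to a scalar.

Uniqueness replaces Schur's lemma by an explicit computation with `rankOne v`, the matrix `v vᵀ J`.
These matrices span `sp`, and `(ad (rankOne v))²` maps everything into the line of `rankOne v`.
Invariance then gives `f W (rankOne v) = c v * quad W v` with a scalar depending on `v`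
(`exists_eq_mul_quad`). Symmetry of `f` forces `c u = c v` as soon as `sympForm u v ≠ 0`, and any
two nonzero vectors are linked through a third one, so `c` is constant. On `ℝ^{2n,2n}` the same
scheme works after `diag(1, -1)` in `sp(1, ℝ)` has split the space into two isotropic halves
(`exists_eq_mul_dotProduct`).

Orthogonality: `sp(n, ℝ)` is perfect and commutes with `sp(1, ℝ)`; each factor contains an element
acting invertibly on `ℝ^{2n,2n}` and commuting with the other factor. -/

namespace SympDecomp

noncomputable section

/-! ### Rank-one elements and invariant forms on the symplectic Lie algebra -/

section Symplectic

variable {l : Type*} [Fintype l] [DecidableEq l]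

/-- The standard symplectic form `(u, v) ↦ uᵀ J v`. -/
def sympForm (u v : l ⊕ l → ℝ) : ℝ := (u ᵥ* Matrix.J l ℝ) ⬝ᵥ v

theorem mulVec_J (u : l ⊕ l → ℝ) : Matrix.J l ℝ *ᵥ u = -(u ᵥ* Matrix.J l ℝ) := by
  rw [← Matrix.vecMul_transpose, Matrix.J_transpose, Matrix.vecMul_neg]

theorem sympForm_swap (u v : l ⊕ l → ℝ) : sympForm u v = -sympForm v u := by
  rw [sympForm, ← Matrix.dotProduct_mulVec, mulVec_J, dotProduct_neg, dotProduct_comm, sympForm]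

theorem sympForm_self (u : l ⊕ l → ℝ) : sympForm u u = 0 := by
  linarith [sympForm_swap u u]

theorem sympForm_add_right (u v w : l ⊕ l → ℝ) :
    sympForm u (v + w) = sympForm u v + sympForm u w := dotProduct_add _ _ _

theorem exists_sympForm_ne_zero {u : l ⊕ l → ℝ} (hu : u ≠ 0) : ∃ t, sympForm u t ≠ 0 := by
  by_contra! h
  refine hu ?_
  have h1 : u ᵥ* Matrix.J l ℝ = 0 := dotProduct_eq_zero _ h
  have h2 := congrArg (fun v => v ᵥ* Matrix.J l ℝ) h1
  simpa [Matrix.vecMul_vecMul, Matrix.J_squared, Matrix.vecMul_neg] using h2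

/-- Two proper subspaces, here the orthogonals of `u` and `v`, never cover the whole space. -/
theorem exists_sympForm_ne_zero₂ {u v : l ⊕ l → ℝ} (hu : u ≠ 0) (hv : v ≠ 0) :
    ∃ t, sympForm u t ≠ 0 ∧ sympForm v t ≠ 0 := by
  obtain ⟨s, hs⟩ := exists_sympForm_ne_zero hu
  obtain ⟨t, ht⟩ := exists_sympForm_ne_zero hv
  by_cases h1 : sympForm v s = 0
  · by_cases h2 : sympForm u t = 0
    · exact ⟨s + t, by simpa [sympForm_add_right, h2], by simpa [sympForm_add_right, h1]⟩
    · exact ⟨t, h2, ht⟩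
  · exact ⟨s, hs, h1⟩

/-- A function on vectors that agrees on non-orthogonal pairs is constant away from zero. -/
theorem exists_forall_eq_of_sympForm {c : (l ⊕ l → ℝ) → ℝ}
    (hc : ∀ u v, sympForm u v ≠ 0 → c u = c v) : ∃ k, ∀ u, u ≠ 0 → c u = k := by
  by_cases h : ∃ v : l ⊕ l → ℝ, v ≠ 0
  · obtain ⟨v, hv⟩ := h
    refine ⟨c v, fun u hu => ?_⟩
    -- The vector `t` links `u` to the base point `v` in two steps.
    obtain ⟨t, h1, h2⟩ := exists_sympForm_ne_zero₂ hu hv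
    rw [hc u t h1, hc v t h2]
  · push Not at h
    exact ⟨0, fun u hu => absurd (h u) hu⟩

/-- The element `v vᵀ J` of the symplectic Lie algebra. -/
def rankOne (v : l ⊕ l → ℝ) : LieAlgebra.Symplectic.sp l ℝ :=
  ⟨Matrix.vecMulVec v (v ᵥ* Matrix.J l ℝ), by
    rw [mem_sp, Matrix.transpose_vecMulVec, Matrix.vecMulVec_mul, Matrix.mul_vecMulVec, mulVec_J,
      Matrix.neg_vecMulVec, neg_neg]⟩

theorem rankOne_mulVec (v t : l ⊕ l → ℝ) : (rankOne v).1 *ᵥ t = sympForm v t • v := by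
  rw [rankOne, Matrix.vecMulVec_mulVec, sympForm, op_smul_eq_smul]

theorem rankOne_transpose_mulVec (v t : l ⊕ l → ℝ) :
    (rankOne v).1ᵀ *ᵥ t = (v ⬝ᵥ t) • (v ᵥ* Matrix.J l ℝ) := by
  rw [rankOne, Matrix.transpose_vecMulVec, Matrix.vecMulVec_mulVec, op_smul_eq_smul]

/-- The quadratic form attached to an element of the symplectic Lie algebra. -/
def quad (W : LieAlgebra.Symplectic.sp l ℝ) (v : l ⊕ l → ℝ) : ℝ := sympForm v (W.1 *ᵥ v)

theorem quad_rankOne (u v : l ⊕ l → ℝ) : quad (rankOne u) v = -sympForm u v ^ 2 := by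
  rw [quad, rankOne_mulVec, sympForm_swap u v]
  simp only [sympForm, dotProduct_smul, smul_eq_mul]
  ring

/-- With `P = rankOne v`, the double bracket is `P²W - 2PWP + WP²`. Here `P² = 0` because `v` is
isotropic, and `PWP = quad W v • P`. -/
theorem lie_rankOne_lie_rankOne (v : l ⊕ l → ℝ) (W : LieAlgebra.Symplectic.sp l ℝ) :
    ⁅rankOne v, ⁅rankOne v, W⁆⁆ = (-2 * quad W v) • rankOne v := by
  have h1 : (rankOne v).1 * (rankOne v).1 = 0 := by
    simp only [rankOne, Matrix.vecMulVec_mul_vecMulVec]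
    rw [← sympForm, sympForm_self, zero_smul, Matrix.vecMulVec_zero]
  have h2 : (rankOne v).1 * W.1 * (rankOne v).1 = quad W v • (rankOne v).1 := by
    simp only [rankOne, quad, sympForm, Matrix.vecMulVec_mul, Matrix.vecMul_vecMulVec,
      Matrix.vecMulVec_smul, Matrix.dotProduct_mulVec]
  apply Subtype.ext
  change (rankOne v).1 * ((rankOne v).1 * W.1 - W.1 * (rankOne v).1) -
    ((rankOne v).1 * W.1 - W.1 * (rankOne v).1) * (rankOne v).1 =
      (-2 * quad W v) • (rankOne v).1
  rw [Matrix.mul_sub, Matrix.sub_mul, ← Matrix.mul_assoc, ← Matrix.mul_assoc, h2, h1,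
    Matrix.mul_assoc W.1, h1]
  simp only [Matrix.zero_mul, Matrix.mul_zero]
  module

/-- Right multiplication by `J` identifies symmetric matrices with `sp`, and symmetric matrices are
spanned by the squares `v vᵀ`. -/
theorem mem_span_rankOne (X : LieAlgebra.Symplectic.sp l ℝ) :
    X ∈ Submodule.span ℝ (Set.range (rankOne (l := l))) := by
  set S : Matrix (l ⊕ l) (l ⊕ l) ℝ := -(X.1 * Matrix.J l ℝ) with hS
  have hSt : Sᵀ = S := by
    rw [hS, Matrix.transpose_neg, Matrix.transpose_mul, Matrix.J_transpose, Matrix.neg_mul,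
      sp_mul_J X.2, neg_neg]
  have hX : X.1 = S * Matrix.J l ℝ := by
    rw [hS, Matrix.neg_mul, Matrix.mul_assoc, Matrix.J_squared, Matrix.mul_neg, Matrix.mul_one,
      neg_neg]
  -- Polarization: the difference of squares equals `E_ij + E_ji`, so summing over all ordered pairs
  -- counts each entry twice, whence the factor `1/2`.
  have hsum : X = ∑ i, ∑ j, (S i j / 2) • (rankOne (Pi.single i 1 + Pi.single j 1) -
      rankOne (Pi.single i 1) - rankOne (Pi.single j 1)) := by
    have hij : ∀ i j, ((rankOne (Pi.single i 1 + Pi.single j 1) - rankOne (Pi.single i 1) -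
        rankOne (Pi.single j 1) : LieAlgebra.Symplectic.sp l ℝ) : Matrix (l ⊕ l) (l ⊕ l) ℝ) =
        (Matrix.single i j 1 + Matrix.single j i 1) * Matrix.J l ℝ := by
      intro i j
      simp only [rankOne, AddSubgroupClass.coe_sub, ← Matrix.vecMulVec_mul,
        Matrix.single_eq_single_vecMulVec_single, ← Matrix.sub_mul, Matrix.add_vecMulVec,
        Matrix.vecMulVec_add]
      congr 1
      abel
    apply Subtype.ext
    simp only [AddSubmonoidClass.coe_finsetSum, SetLike.val_smul, hij, ← Matrix.smul_mul,
      ← Finset.sum_mul]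
    rw [hX]
    congr 1
    have e1 : S = ∑ i, ∑ j, (S i j) • Matrix.single i j (1 : ℝ) := by
      conv_lhs => rw [Matrix.matrix_eq_sum_single S]
      simp [Matrix.smul_single]
    have e2 : S = ∑ i, ∑ j, (S i j) • Matrix.single j i (1 : ℝ) := by
      conv_lhs => rw [e1]
      rw [Finset.sum_comm]
      refine Finset.sum_congr rfl fun i _ => Finset.sum_congr rfl fun j _ => ?_
      rw [← hSt, Matrix.transpose_apply, hSt]
    have e3 : S = (1 / 2 : ℝ) • ((∑ i, ∑ j, (S i j) • Matrix.single i j (1 : ℝ)) +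
        ∑ i, ∑ j, (S i j) • Matrix.single j i (1 : ℝ)) := by
      rw [← e1, ← e2]
      module
    conv_lhs => rw [e3]
    simp only [← Finset.sum_add_distrib, Finset.smul_sum]
    refine Finset.sum_congr rfl fun i _ => Finset.sum_congr rfl fun j _ => ?_
    module
  have hr : ∀ v : l ⊕ l → ℝ, rankOne v ∈ Submodule.span ℝ (Set.range (rankOne (l := l))) :=
    fun v => Submodule.subset_span ⟨v, rfl⟩
  rw [hsum]
  exact Submodule.sum_mem _ fun i _ => Submodule.sum_mem _ fun j _ =>
    Submodule.smul_mem _ _ (sub_mem (sub_mem (hr _) (hr _)) (hr _))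

theorem linearMap_ext_rankOne {M : Type*} [AddCommMonoid M] [Module ℝ M]
    {f g : LieAlgebra.Symplectic.sp l ℝ →ₗ[ℝ] M} (h : ∀ v, f (rankOne v) = g (rankOne v)) :
    f = g :=
  LinearMap.ext fun X => LinearMap.eqOn_span (s := Set.range rankOne)
    (by rintro _ ⟨v, rfl⟩; exact h v) (mem_span_rankOne X)

/-- An invariant symmetric form on the symplectic Lie algebra is determined by one scalar. -/
theorem exists_eq_mul_quad {f : LinearMap.BilinForm ℝ (LieAlgebra.Symplectic.sp l ℝ)}
    (hs : f.IsSymm) (hf : f.lieInvariant (LieAlgebra.Symplectic.sp l ℝ)) :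
    ∃ c, ∀ W v, f W (rankOne v) = c * quad W v := by
  -- The square of a skew operator is self-adjoint: moving `(ad (rankOne v))²` across `f` costs two
  -- signs.
  have hswap : ∀ W W' v, quad W v * f (rankOne v) W' = quad W' v * f W (rankOne v) := by
    intro W W' v
    have h : f ⁅rankOne v, ⁅rankOne v, W⁆⁆ W' = f W ⁅rankOne v, ⁅rankOne v, W'⁆⁆ := by
      rw [hf, hf, neg_neg]
    rw [lie_rankOne_lie_rankOne, lie_rankOne_lie_rankOne] at h
    simp only [map_smul, LinearMap.smul_apply, smul_eq_mul] at h
    linarith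
  have hloc : ∀ v, ∃ c, v ≠ 0 → ∀ W, f W (rankOne v) = c * quad W v := by
    intro v
    by_cases hv : v = 0
    · exact ⟨0, fun h => absurd hv h⟩
    obtain ⟨t, ht⟩ := exists_sympForm_ne_zero hv
    have hq : quad (rankOne t) v ≠ 0 := by
      rw [quad_rankOne, sympForm_swap]
      simpa using ht
    refine ⟨f (rankOne v) (rankOne t) / quad (rankOne t) v, fun _ W => ?_⟩
    have := hswap W (rankOne t) v
    field_simp
    linarith
  choose c hc using hloc
  -- Evaluating `f (rankOne u) (rankOne v)` in both orders gives `c u` and `c v` times the same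
  -- factor `-sympForm u v ^ 2`.
  obtain ⟨k, hk⟩ := exists_forall_eq_of_sympForm (c := c) fun u v huv => by
    have hu : u ≠ 0 := by rintro rfl; simp [sympForm] at huv
    have hv : v ≠ 0 := by rintro rfl; simp [sympForm] at huv
    have h1 := hc u hu (rankOne v)
    have h2 := hc v hv (rankOne u)
    rw [quad_rankOne] at h1 h2
    rw [hs.eq] at h1
    rw [sympForm_swap v u, neg_sq] at h1
    have : (c u - c v) * sympForm u v ^ 2 = 0 := by
      have : f (rankOne u) (rankOne v) = f (rankOne u) (rankOne v) := rfl
      linarith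
    simpa [huv, sub_eq_zero] using this
  refine ⟨k, fun W v => ?_⟩
  by_cases hv : v = 0
  · subst hv
    have : rankOne (0 : l ⊕ l → ℝ) = 0 := Subtype.ext (by simp [rankOne])
    simp [this, quad, sympForm]
  · rw [hc v hv, hk v hv]

theorem exists_eq_smul_of_lieInvariant_sp
    {f g : LinearMap.BilinForm ℝ (LieAlgebra.Symplectic.sp l ℝ)}
    (hf : f.IsSymm) (hf' : f.lieInvariant (LieAlgebra.Symplectic.sp l ℝ))
    (hg : g.IsSymm) (hg' : g.lieInvariant (LieAlgebra.Symplectic.sp l ℝ))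
    (hg0 : g.Nondegenerate) : ∃ a : ℝ, f = a • g := by
  obtain ⟨c, hc⟩ := exists_eq_mul_quad hf hf'
  obtain ⟨d, hd⟩ := exists_eq_mul_quad hg hg'
  -- If `d = 0` then `g` vanishes, so nondegeneracy makes the algebra zero and any scalar serves.
  by_cases h : d = 0
  · refine ⟨0, LinearMap.ext fun W => ?_⟩
    have hW : W = 0 := by
      refine hg0.1 W fun W' => ?_
      have : g W = 0 := linearMap_ext_rankOne fun v => by simp [hd, h]
      simp [this]
    simp [hW]
  · refine ⟨c / d, LinearMap.ext fun W => linearMap_ext_rankOne fun v => ?_⟩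
    simp only [LinearMap.smul_apply, hc, hd, smul_eq_mul]
    field_simp

end Symplectic

/-! ### Invariant forms on `ℝ^{2n,2n}` -/

/-- The element `diag(1, -1)` of `sp(1, ℝ)`. -/
def diagOne : sp 1 := ⟨Matrix.fromBlocks 1 0 0 (-1), by
  rw [mem_sp_iff]
  refine ⟨fun i j => ?_, fun i j => ?_, fun i j => ?_⟩ <;>
    simp [Subsingleton.elim i j]⟩

theorem diagOne_lie (n : ℕ) (v w : Fin n ⊕ Fin n → ℝ) :
    ⁅((0, diagOne) : sp n × sp 1), (Sum.elim v w : R22 n)⁆ = Sum.elim v (-w) := by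
  rw [lie_R22, actMatrix_eq, Matrix.fromBlocks_mulVec]
  simp [diagOne, Matrix.neg_mulVec]

/-- The two halves are the standard module of `sp(n, ℝ)` and its dual. -/
theorem sp_lie (n : ℕ) (X : sp n) (v w : Fin n ⊕ Fin n → ℝ) :
    ⁅((X, 0) : sp n × sp 1), (Sum.elim v w : R22 n)⁆ =
      Sum.elim (X.1 *ᵥ v) (-(X.1ᵀ *ᵥ w)) := by
  rw [lie_R22, actMatrix_eq, Matrix.fromBlocks_mulVec]
  simp [Matrix.neg_mulVec]

/-- An invariant symmetric form on `ℝ^{2n,2n}` is a multiple of the standard one. -/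
theorem exists_eq_mul_dotProduct {n : ℕ} {f : LinearMap.BilinForm ℝ (R22 n)}
    (hs : f.IsSymm) (hf : f.lieInvariant (sp n × sp 1)) :
    ∃ c, ∀ v₁ v₂ w₁ w₂ : Fin n ⊕ Fin n → ℝ,
      f (Sum.elim v₁ v₂) (Sum.elim w₁ w₂) = c * (v₁ ⬝ᵥ w₂ + w₁ ⬝ᵥ v₂) := by
  have hsplit : ∀ v w : Fin n ⊕ Fin n → ℝ,
      (Sum.elim v w : R22 n) = Sum.elim v 0 + (Sum.elim 0 w : R22 n) := by
    intro v w
    ext (i | i) <;> simp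
  -- Each half is an eigenspace of `diagOne` with nonzero eigenvalue, so invariance makes it
  -- isotropic.
  have hll : ∀ v w : Fin n ⊕ Fin n → ℝ, f (Sum.elim v 0) (Sum.elim w 0) = 0 := by
    intro v w
    have h := hf (0, diagOne) (Sum.elim v 0) (Sum.elim w 0)
    rw [diagOne_lie, diagOne_lie, neg_zero] at h
    linarith
  have hrr : ∀ v w : Fin n ⊕ Fin n → ℝ, f (Sum.elim 0 v) (Sum.elim 0 w) = 0 := by
    intro v w
    have hneg : ∀ u : Fin n ⊕ Fin n → ℝ, (Sum.elim 0 (-u) : R22 n) = -(Sum.elim 0 u : R22 n) := by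
      intro u
      ext (i | i) <;> simp
    have h := hf (0, diagOne) (Sum.elim 0 v) (Sum.elim 0 w)
    rw [diagOne_lie, diagOne_lie, hneg, hneg] at h
    simp only [map_neg, LinearMap.neg_apply, neg_neg] at h
    linarith
  have hsmul : ∀ (r : ℝ) (v : Fin n ⊕ Fin n → ℝ),
      (Sum.elim (r • v) 0 : R22 n) = r • Sum.elim v 0 := by
    intro r v
    ext (i | i) <;> simp
  have hsmul' : ∀ (r : ℝ) (v : Fin n ⊕ Fin n → ℝ),
      (Sum.elim 0 (-(r • v)) : R22 n) = -(r • (Sum.elim 0 v : R22 n)) := by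
    intro r v
    ext (i | i) <;> simp
  -- Invariance under `rankOne u`, which sends the first half to multiples of `u` and the second to
  -- multiples of `u ᵥ* J`.
  have hswap : ∀ u v w : Fin n ⊕ Fin n → ℝ,
      sympForm u v * f (Sum.elim u 0) (Sum.elim 0 w) =
        (u ⬝ᵥ w) * f (Sum.elim v 0) (Sum.elim 0 (u ᵥ* Matrix.J (Fin n) ℝ)) := by
    intro u v w
    have h := hf (rankOne u, 0) (Sum.elim v 0) (Sum.elim 0 w)
    rw [sp_lie, sp_lie, rankOne_mulVec, rankOne_transpose_mulVec, rankOne_transpose_mulVec,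
      Matrix.mulVec_zero, dotProduct_zero, zero_smul, neg_zero, hsmul, hsmul'] at h
    simpa using h
  have hloc : ∀ u : Fin n ⊕ Fin n → ℝ, ∃ c, u ≠ 0 →
      ∀ w, f (Sum.elim u 0) (Sum.elim 0 w) = c * (u ⬝ᵥ w) := by
    intro u
    by_cases hu : u = 0
    · exact ⟨0, fun h => absurd hu h⟩
    obtain ⟨t, ht⟩ := exists_sympForm_ne_zero hu
    refine ⟨f (Sum.elim t 0) (Sum.elim 0 (u ᵥ* Matrix.J (Fin n) ℝ)) / sympForm u t,
      fun _ w => ?_⟩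
    have := hswap u t w
    field_simp
    linarith
  choose c hc using hloc
  obtain ⟨k, hk⟩ := exists_forall_eq_of_sympForm (c := c) fun u v huv => by
    have hu : u ≠ 0 := by rintro rfl; simp [sympForm] at huv
    have hv : v ≠ 0 := by rintro rfl; simp [sympForm] at huv
    -- Taking `w = u` brings in `u ⬝ᵥ u`, which is nonzero over the reals, while `v ⬝ᵥ (u ᵥ* J)` is
    -- again `sympForm u v`.
    have h := hswap u v u
    rw [hc u hu, hc v hv, dotProduct_comm v, ← sympForm] at h
    have huu : u ⬝ᵥ u ≠ 0 := by simpa [dotProduct_self_eq_zero] using hu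
    have : (sympForm u v * (u ⬝ᵥ u)) * (c u - c v) = 0 := by linarith
    simpa [huv, hu, sub_eq_zero] using this
  have hlr : ∀ v w : Fin n ⊕ Fin n → ℝ, f (Sum.elim v 0) (Sum.elim 0 w) = k * (v ⬝ᵥ w) := by
    intro v w
    by_cases hv : v = 0
    · subst hv
      have : (Sum.elim 0 0 : R22 n) = 0 := Sum.elim_zero_zero
      simp [this]
    · rw [hc v hv, hk v hv]
  refine ⟨k, fun v₁ v₂ w₁ w₂ => ?_⟩
  rw [hsplit v₁ v₂, hsplit w₁ w₂]
  simp only [map_add, LinearMap.add_apply, hll, hrr, hlr, zero_add, add_zero]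
  rw [hs.eq, hlr]
  ring

theorem exists_eq_smul_of_lieInvariant_R22 {n : ℕ} {f g : LinearMap.BilinForm ℝ (R22 n)}
    (hf : f.IsSymm) (hf' : f.lieInvariant (sp n × sp 1))
    (hg : g.IsSymm) (hg' : g.lieInvariant (sp n × sp 1)) (hg0 : g.Nondegenerate) :
    ∃ a : ℝ, f = a • g := by
  obtain ⟨c, hc⟩ := exists_eq_mul_dotProduct hf hf'
  obtain ⟨d, hd⟩ := exists_eq_mul_dotProduct hg hg'
  have hc' : ∀ v w : R22 n, f v w =
      c * ((v ∘ Sum.inl) ⬝ᵥ (w ∘ Sum.inr) + (w ∘ Sum.inl) ⬝ᵥ (v ∘ Sum.inr)) := fun v w => by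
    rw [← hc, Sum.elim_comp_inl_inr, Sum.elim_comp_inl_inr]
  have hd' : ∀ v w : R22 n, g v w =
      d * ((v ∘ Sum.inl) ⬝ᵥ (w ∘ Sum.inr) + (w ∘ Sum.inl) ⬝ᵥ (v ∘ Sum.inr)) := fun v w => by
    rw [← hd, Sum.elim_comp_inl_inr, Sum.elim_comp_inl_inr]
  by_cases h : d = 0
  · refine ⟨0, LinearMap.ext fun v => ?_⟩
    have hv : v = 0 := hg0.1 v fun w => by rw [hd', h, zero_mul]
    simp [hv]
  · refine ⟨c / d, LinearMap.ext fun v => LinearMap.ext fun w => ?_⟩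
    simp only [LinearMap.smul_apply, hc', hd', smul_eq_mul]
    field_simp

/-- A linear map on the symplectic Lie algebra that vanishes on brackets is zero. -/
theorem eq_zero_of_lie_eq_zero {l M : Type*} [Fintype l] [DecidableEq l] [AddCommGroup M] [Module ℝ M]
    (f : LieAlgebra.Symplectic.sp l ℝ →ₗ[ℝ] M)
    (hf : ∀ X Y : LieAlgebra.Symplectic.sp l ℝ, f ⁅X, Y⁆ = 0) : f = 0 := by
  refine linearMap_ext_rankOne fun v => ?_
  by_cases hv : v = 0
  · subst hv
    have : rankOne (0 : l ⊕ l → ℝ) = 0 := Subtype.ext (by simp [rankOne])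
    simp [this]
  obtain ⟨t, ht⟩ := exists_sympForm_ne_zero hv
  -- This bracket is `2 * sympForm v t ^ 2` times `rankOne v`, so `rankOne v` is itself a multiple
  -- of a bracket.
  have h := hf (rankOne v) ⁅rankOne v, rankOne t⁆
  rw [lie_rankOne_lie_rankOne, quad_rankOne, sympForm_swap, map_smul] at h
  simpa [ht] using h

theorem map_diag_eq_zero {n : ℕ} {M : Type*} [AddCommGroup M] [Module ℝ M] (f : R22 n →ₗ[ℝ] M)
    (hf : ∀ v, f ⁅((0, diagOne) : sp n × sp 1), v⁆ = 0) : f = 0 := by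
  refine LinearMap.ext fun v => ?_
  have h := hf (Sum.elim (v ∘ Sum.inl) (-(v ∘ Sum.inr)))
  rwa [diagOne_lie, neg_neg, Sum.elim_comp_inl_inr] at h

/-- The element `diag(1, -1)` of `sp(n, ℝ)`. -/
def diagN (n : ℕ) : sp n := ⟨Matrix.fromBlocks 1 0 0 (-1), by
  rw [mem_sp_iff]
  refine ⟨fun i j => ?_, fun i j => ?_, fun i j => ?_⟩ <;> simp [Matrix.one_apply, eq_comm]⟩

/-- Counterpart of `diagOne` inside `sp(n, ℝ)`: it acts invertibly, as an involution, and commutes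
with `sp(1, ℝ)`. -/
theorem diagN_lie_lie (n : ℕ) (v : R22 n) :
    ⁅((diagN n, 0) : sp n × sp 1), ⁅((diagN n, 0) : sp n × sp 1), v⁆⁆ = v := by
  have h1 : (diagN n).1 * (diagN n).1 = 1 := by
    simp [diagN, Matrix.fromBlocks_multiply]
  have h2 : (diagN n).1ᵀ * (diagN n).1ᵀ = 1 := by
    rw [← Matrix.transpose_mul, h1, Matrix.transpose_one]
  rw [← Sum.elim_comp_inl_inr v, sp_lie, sp_lie]
  simp [Matrix.mulVec_neg, h1, h2]

/-! ### The Killing form relative to the decomposition -/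

namespace Decomposition

variable {n : ℕ} (D : Decomposition n)

theorem killingForm_lie (x y z : sp (n + 1)) :
    killingForm ℝ (sp (n + 1)) ⁅x, y⁆ z = -killingForm ℝ (sp (n + 1)) y ⁅x, z⁆ :=
  LieModule.traceForm_apply_lie_apply' _ _ _ x y z

/-- For fixed `Y` the form kills brackets of `sp(n, ℝ)`, since `K([A, B], Y) = -K(B, [A, Y])` and
`[A, Y] = 0`; perfectness concludes. -/
theorem killingForm_left_right (X : sp n) (Y : sp 1) :
    killingForm ℝ (sp (n + 1)) (D.incl (X, 0)) (D.incl (0, Y)) = 0 := by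
  let f : sp n →ₗ[ℝ] ℝ := (killingForm ℝ (sp (n + 1))).flip (D.incl (0, Y)) ∘ₗ
    (D.incl : (sp n × sp 1) →ₗ[ℝ] sp (n + 1)) ∘ₗ LinearMap.inl ℝ (sp n) (sp 1)
  have hf : f = 0 := eq_zero_of_lie_eq_zero f fun A B => by
    change killingForm ℝ (sp (n + 1)) (D.incl (⁅A, B⁆, 0)) (D.incl (0, Y)) = 0
    have h1 : ((⁅A, B⁆, 0) : sp n × sp 1) = ⁅((A, 0) : sp n × sp 1), ((B, 0) : sp n × sp 1)⁆ := by
      simp [LieAlgebra.Prod.bracket_apply]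
    have h2 : ⁅((A, 0) : sp n × sp 1), ((0, Y) : sp n × sp 1)⁆ = 0 := by
      simp [LieAlgebra.Prod.bracket_apply]
    rw [h1, LieHom.map_lie, killingForm_lie, ← LieHom.map_lie, h2]
    simp
  exact LinearMap.congr_fun hf X

/-- Every vector has the form `diagOne · w`, and invariance moves `diagOne` onto `X`, with which it
commutes. -/
theorem killingForm_left_emb (X : sp n) (v : R22 n) :
    killingForm ℝ (sp (n + 1)) (D.incl (X, 0)) (D.emb v) = 0 := by
  refine LinearMap.congr_fun (map_diag_eq_zero
    (killingForm ℝ (sp (n + 1)) (D.incl (X, 0)) ∘ₗ D.emb) fun w => ?_) v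
  have h2 : ⁅((0, diagOne) : sp n × sp 1), ((X, 0) : sp n × sp 1)⁆ = 0 := by
    simp [LieAlgebra.Prod.bracket_apply]
  rw [LinearMap.comp_apply, D.emb_lie, ← neg_inj, ← killingForm_lie, ← LieHom.map_lie, h2]
  simp

theorem killingForm_right_emb (Y : sp 1) (v : R22 n) :
    killingForm ℝ (sp (n + 1)) (D.incl (0, Y)) (D.emb v) = 0 := by
  have h2 : ⁅((diagN n, 0) : sp n × sp 1), ((0, Y) : sp n × sp 1)⁆ = 0 := by
    simp [LieAlgebra.Prod.bracket_apply]
  rw [← diagN_lie_lie n v, D.emb_lie, ← neg_inj, ← killingForm_lie, ← LieHom.map_lie, h2]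
  simp

theorem killingForm_incl_eq_smul {B : LinearMap.BilinForm ℝ (sp n)} (hs : B.IsSymm)
    (hB : B.lieInvariant (sp n)) (h0 : B.Nondegenerate) :
    ∃ a : ℝ, ∀ X X' : sp n, killingForm ℝ (sp (n + 1)) (D.incl (X, 0)) (D.incl (X', 0)) =
      a * B X X' := by
  let j : sp n →ₗ[ℝ] sp (n + 1) :=
    (D.incl : (sp n × sp 1) →ₗ[ℝ] sp (n + 1)) ∘ₗ LinearMap.inl ℝ (sp n) (sp 1)
  have hj : ∀ A C, j ⁅A, C⁆ = ⁅j A, j C⁆ := fun A C => by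
    change D.incl (⁅A, C⁆, 0) = ⁅D.incl (A, 0), D.incl (C, 0)⁆
    rw [← LieHom.map_lie, LieAlgebra.Prod.bracket_apply]
    simp
  obtain ⟨a, ha⟩ := exists_eq_smul_of_lieInvariant_sp
    (f := (killingForm ℝ (sp (n + 1))).comp j j)
    ⟨fun A C => LieModule.traceForm_comm _ _ _ (j A) (j C)⟩
    (fun A C E => by
      rw [LinearMap.BilinForm.comp_apply, LinearMap.BilinForm.comp_apply, hj, hj, killingForm_lie])
    hs hB h0
  exact ⟨a, fun X X' => LinearMap.congr_fun (LinearMap.congr_fun ha X) X'⟩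

theorem killingForm_incl_eq_smul' {B : LinearMap.BilinForm ℝ (sp 1)} (hs : B.IsSymm)
    (hB : B.lieInvariant (sp 1)) (h0 : B.Nondegenerate) :
    ∃ a : ℝ, ∀ Y Y' : sp 1, killingForm ℝ (sp (n + 1)) (D.incl (0, Y)) (D.incl (0, Y')) =
      a * B Y Y' := by
  let j : sp 1 →ₗ[ℝ] sp (n + 1) :=
    (D.incl : (sp n × sp 1) →ₗ[ℝ] sp (n + 1)) ∘ₗ LinearMap.inr ℝ (sp n) (sp 1)
  have hj : ∀ A C, j ⁅A, C⁆ = ⁅j A, j C⁆ := fun A C => by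
    change D.incl (0, ⁅A, C⁆) = ⁅D.incl (0, A), D.incl (0, C)⁆
    rw [← LieHom.map_lie, LieAlgebra.Prod.bracket_apply]
    simp
  obtain ⟨a, ha⟩ := exists_eq_smul_of_lieInvariant_sp
    (f := (killingForm ℝ (sp (n + 1))).comp j j)
    ⟨fun A C => LieModule.traceForm_comm _ _ _ (j A) (j C)⟩
    (fun A C E => by
      rw [LinearMap.BilinForm.comp_apply, LinearMap.BilinForm.comp_apply, hj, hj, killingForm_lie])
    hs hB h0
  exact ⟨a, fun X X' => LinearMap.congr_fun (LinearMap.congr_fun ha X) X'⟩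

theorem killingForm_emb_eq_smul {B : LinearMap.BilinForm ℝ (R22 n)} (hs : B.IsSymm)
    (hB : B.lieInvariant (sp n × sp 1)) (h0 : B.Nondegenerate) :
    ∃ a : ℝ, ∀ v v' : R22 n, killingForm ℝ (sp (n + 1)) (D.emb v) (D.emb v') = a * B v v' := by
  obtain ⟨a, ha⟩ := exists_eq_smul_of_lieInvariant_R22
    (f := (killingForm ℝ (sp (n + 1))).comp D.emb D.emb)
    ⟨fun v w => LieModule.traceForm_comm _ _ _ (D.emb v) (D.emb w)⟩
    (fun x v w => by
      rw [LinearMap.BilinForm.comp_apply, LinearMap.BilinForm.comp_apply, D.emb_lie, D.emb_lie,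
        killingForm_lie])
    hs hB h0
  exact ⟨a, fun v v' => LinearMap.congr_fun (LinearMap.congr_fun ha v) v'⟩

end Decomposition

end

end SympDecomp

theorem mainTheorem9 (n : ℕ) (hn : 3 ≤ n) (D : SympDecomp.Decomposition n)
    (Bn : LinearMap.BilinForm ℝ (SympDecomp.sp n))
    (B1 : LinearMap.BilinForm ℝ (SympDecomp.sp 1))
    (B0 : LinearMap.BilinForm ℝ (SympDecomp.R22 n))
    (hn_symm : Bn.IsSymm) (hn_nondeg : Bn.Nondegenerate)
    (hn_inv : Bn.lieInvariant (SympDecomp.sp n))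
    (h1_symm : B1.IsSymm) (h1_nondeg : B1.Nondegenerate)
    (h1_inv : B1.lieInvariant (SympDecomp.sp 1))
    (h0_symm : B0.IsSymm) (h0_nondeg : B0.Nondegenerate)
    (h0_inv : B0.lieInvariant (SympDecomp.sp n × SympDecomp.sp 1)) :
    ∃ a0 a1 an : ℝ, ∀ (X X' : SympDecomp.sp n) (Y Y' : SympDecomp.sp 1)
        (v v' : SympDecomp.R22 n),
      killingForm ℝ (SympDecomp.sp (n + 1))
          (D.incl (X, Y) + D.emb v) (D.incl (X', Y') + D.emb v') =
        a0 * B0 v v' + a1 * B1 Y Y' + an * Bn X X' := by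
  obtain ⟨a0, h0⟩ := D.killingForm_emb_eq_smul h0_symm h0_inv h0_nondeg
  obtain ⟨a1, h1⟩ := D.killingForm_incl_eq_smul' h1_symm h1_inv h1_nondeg
  obtain ⟨an, hn'⟩ := D.killingForm_incl_eq_smul hn_symm hn_inv hn_nondeg
  refine ⟨a0, a1, an, fun X X' Y Y' v v' => ?_⟩
  have hsplit : ∀ (X : SympDecomp.sp n) (Y : SympDecomp.sp 1),
      D.incl (X, Y) = D.incl (X, 0) + D.incl (0, Y) := fun X Y => by
    rw [← map_add, Prod.mk_add_mk, add_zero, zero_add]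
  have hc : ∀ x y, killingForm ℝ (SympDecomp.sp (n + 1)) x y =
      killingForm ℝ (SympDecomp.sp (n + 1)) y x := LieModule.traceForm_comm _ _ _
  rw [hsplit X Y, hsplit X' Y']
  -- Of the nine terms of the expansion, the six mixed ones vanish; `hc` turns three of them into
  -- the order of the orthogonality lemmas.
  simp only [map_add, LinearMap.add_apply, h0, h1, hn', D.killingForm_left_right,
    D.killingForm_left_emb, D.killingForm_right_emb, hc (D.incl (0, Y)) (D.incl (X', 0)),
    hc (D.emb v) (D.incl _)]
  ring
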